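/- Let $X$ be a real Hausdorff locally convex topological vector space, let $K\subseteq X$ be nonempty, convex and compact, and let $D\subseteq K$ be self segment-dense in $K$; that is, $D$ is dense in $K$ and, for all $x,y\in D$, the set $[x,y]\cap D$ is dense in the closed segment $[x,y]$. Let $F:K\times K\rightrightarrows\mathbb{R}$ be a set-valued map (its values are arbitrary subsets of $\mathbb{R}$). Here a set-valued map $T:K\rightrightarrows\mathbb{R}$ is called lower semicontinuous at $x\in K$ if for every open $N\subseteq\mathbb{R}$ with $T(x)\cap N\neq\emptyset$ there is a neighbourhood $M$ of $x$ such that $T(x')\cap N\neq\emptyset$ for all $x'\in M\cap K$. It is called convex on $D$ if, for all $n\geq 1$, $y_1,\dots,y_n\in D$ and $\lambda_1,\dots,\lambda_n\geq 0$ with $\sum_{i=1}^n\lambda_i=1$ and $\sum_{i=1}^n\lambda_iy_i\in D$, one has $\sum_{i=1}^n\lambda_iT(y_i)\subseteq T\big(\sum_{i=1}^n\lambda_iy_i\big)$, where the sum on the left is the Minkowski sum. Suppose that (i) for every $y\in D$, the map $x\mapsto F(x,y)$ is lower semicontinuous at every point of $K$; (ii) for every $x\in K$, the map $y\mapsto F(x,y)$,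 defined on $K$, is lower semicontinuous at every point of $K\setminus D$; (iii) for every $x\in D$, the map $y\mapsto F(x,y)$ is convex on $D$; (iv) for every $x\in D$, $F(x,x)\subseteq[0,\infty)$. Then there exists $x_0\in K$ such that $F(x_0,y)\subseteq[0,\infty)$ for all $y\in K$. -/

import Mathlib

open scoped Pointwise

/-- `U` is self segment-dense in the convex set `V`: `U` is a dense subset of `V`, and for any two
points of `U` the part of the closed segment between them that lies in `U` is dense in that
segment. -/
structure IsSelfSegmentDense {X : Type*} [AddCommGroup X] [Module ℝ X] [TopologicalSpace X]
    (U V : Set X) : Prop where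
  convex : Convex ℝ V
  subset : U ⊆ V
  dense : V ⊆ closure U
  segment_dense : ∀ x ∈ U, ∀ y ∈ U, segment ℝ x y ⊆ closure (segment ℝ x y ∩ U)

/-- Convexity of a set-valued map `T` on a set `D` that need not be convex: for every convex
combination of points of `D` that lies in `D` again, the Minkowski combination of the values of `T`
is contained in the value of `T` at the combination. -/
def SetValuedConvexOn {X : Type*} [AddCommGroup X] [Module ℝ X]
    (D : Set X) (T : X → Set ℝ) : Prop :=
  ∀ (n : ℕ) (x : Fin n → X) (w : Fin n → ℝ),
    (∀ i, x i ∈ D) → (∀ i, 0 ≤ w i) → ∑ i, w i = 1 → ∑ i, w i • x i ∈ D →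
      ∑ i, w i • T (x i) ⊆ T (∑ i, w i • x i)

/-! For y in D let G(y) be the set of x in K with F(x,y) ⊆ [0,∞); it is closed by lower
semicontinuity in x. If x in D is a convex combination of finitely many points of D, then x lies in
G(y) for one of these points y: otherwise every F(x,y) has a negative element, and convexity puts a
negative number into F(x,x). Such x are dense in the hull
(`IsSelfSegmentDense.convexHull_subset_closure`), so the closed sets G(y) cover the whole hull. The
KKM lemma and compactness of K give a point x₀ common to all G(y), and lower semicontinuity in y
carries the inclusion from D to K.

KKM is derived from Brouwer's theorem, and Brouwer's theorem from Scarf's lemma, a parity argument.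
-/

/-- `S` is dominant for the preference functions `r i` if every point is weakly below all of `S`
with respect to one of them. -/
def IsDominant {V I α : Type*} [LE α] (r : I → V → α) (S : Finset V) : Prop :=
  ∀ y, ∃ i, ∀ x ∈ S, r i y ≤ r i x

theorem IsDominant.mono {V I α : Type*} [LE α] {r : I → V → α} {S S' : Finset V}
    (h : IsDominant r S) (hS : S' ⊆ S) : IsDominant r S' := fun y =>
  (h y).imp fun _ hi x hx => hi x (hS hx)

/-! ### Dominant sets and Scarf's lemma. -/

section Scarf

variable {V I α : Type*} [Fintype V] [DecidableEq V] [Fintype I] [DecidableEq I] [LinearOrder α]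
  {r : I → V → α}

/-- Among the points beating the thresholds `r l (m l)` for all `l ≠ k`, the one with the largest `r
k` works: any `y` is either below it in `r k` or below some threshold with `l ≠ k`. -/
theorem IsDominant.exists_insert {S : Finset V} {m : I → V}
    (hS : IsDominant r S) (hmS : ∀ i, m i ∈ S) (hm : ∀ i, ∀ s ∈ S, r i (m i) ≤ r i s)
    (k : I) (hk : ∀ s ∈ S, ∃ l, l ≠ k ∧ m l = s) (hne : ∃ y, ∀ l, l ≠ k → r l (m l) < r l y) :
    ∃ x, x ∉ S ∧ IsDominant r (insert x S) ∧ ∀ l, l ≠ k → r l (m l) < r l x := by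
  obtain ⟨y₀, hy₀⟩ := hne
  obtain ⟨x, hx, hmax⟩ := Finset.exists_max_image
    (Finset.univ.filter fun y => ∀ l, l ≠ k → r l (m l) < r l y) (r k) ⟨y₀, by simpa using hy₀⟩
  simp only [Finset.mem_filter, Finset.mem_univ, true_and] at hx hmax
  refine ⟨x, fun hxS => ?_, fun y => ?_, hx⟩
  · obtain ⟨l, hl, rfl⟩ := hk x hxS
    exact lt_irrefl _ (hx l hl)
  · by_cases hy : ∀ l, l ≠ k → r l (m l) < r l y
    · refine ⟨k, ?_⟩
      rw [Finset.forall_mem_insert]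
      refine ⟨hmax y hy, fun s hs => (hmax y hy).trans ?_⟩
      obtain ⟨l, hl⟩ := hS x
      by_cases hlk : l = k
      · exact hlk ▸ hl s hs
      · exact absurd (hl _ (hmS l)) (not_le.2 (hx l hlk))
    · push Not at hy
      obtain ⟨l, hl, hyl⟩ := hy
      refine ⟨l, ?_⟩
      rw [Finset.forall_mem_insert]
      exact ⟨hyl.trans (hx l hl).le, fun s hs => hyl.trans (hm l s hs)⟩

-- Assigning to each point of `insert x S` an index for which it is minimal there is injective,
-- hence bijective by cardinality. The index of `x` serves as `k`; every other index belongs to a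
-- point of `S`.
omit [Fintype V] in
theorem IsDominant.le_of_insert (hr : ∀ i, Function.Injective (r i)) {S : Finset V} {m : I → V}
    (hcard : S.card + 1 = Fintype.card I) (hmS : ∀ i, m i ∈ S)
    (hm : ∀ i, ∀ s ∈ S, r i (m i) ≤ r i s) {x : V} (hx : x ∉ S)
    (hdom : IsDominant r (insert x S)) :
    ∃ k, (∀ l, l ≠ k → r l (m l) < r l x) ∧ ∀ s ∈ S, ∃ l, l ≠ k ∧ m l = s := by
  obtain ⟨k, hk⟩ := hdom x
  rw [Finset.forall_mem_insert] at hk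
  choose g hg using fun s : V => hdom s
  have hginj : Set.InjOn g (insert x S : Finset V) := by
    intro a ha b hb hab
    exact hr (g a) (le_antisymm (hg a b hb) (hab ▸ hg b a ha))
  have himg : (insert x S).image g = Finset.univ := by
    rw [← Finset.card_eq_iff_eq_univ, Finset.card_image_of_injOn hginj,
      Finset.card_insert_of_notMem hx, hcard]
  refine ⟨g x, fun l hl => ?_, fun s hs => ⟨g s, fun h => ?_, ?_⟩⟩
  · obtain ⟨s, hs, rfl⟩ := Finset.mem_image.1 (himg ▸ Finset.mem_univ l)
    have hsS : s ∈ S := (Finset.mem_insert.1 hs).resolve_left fun h => hl (h ▸ rfl)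
    refine (hm _ s hsS).trans_lt ((hg s x (Finset.mem_insert_self _ _)).lt_of_ne fun h => ?_)
    exact hx (hr _ h ▸ hsS)
  · exact hx (hginj (Finset.mem_insert_of_mem hs) (Finset.mem_insert_self _ _) h ▸ hs)
  · exact hr (g s) (le_antisymm (hm _ s hs) (hg s _ (Finset.mem_insert_of_mem (hmS _))))

open Classical in
/-- A dominant set with one point fewer than there are preference functions extends to a dominant
set in exactly two ways, unless it is extremal. -/
theorem IsDominant.card_insert_eq_two (hr : ∀ i, Function.Injective (r i)) {S : Finset V}
    (hS : IsDominant r S) (hSne : S.Nonempty) (hcard : S.card + 1 = Fintype.card I)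
    (hne : ∀ k, ∃ y, ∀ l, l ≠ k → ∃ s ∈ S, r l s < r l y) :
    (Finset.univ.filter fun x => x ∉ S ∧ IsDominant r (insert x S)).card = 2 := by
  choose m hmS hm using fun i => Finset.exists_min_image S (r i) hSne
  -- `m` will turn out to be onto `S`, so `i, j` is its only coincidence. Only these two indices can
  -- be freed, and each yields one extension.
  obtain ⟨i, -, j, -, hij, hmij⟩ := Finset.exists_ne_map_eq_of_card_lt_of_maps_to
    (s := (Finset.univ : Finset I)) (t := S) (f := m)
    (by rw [Finset.card_univ]; omega) fun i _ => hmS i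
  have hne' : ∀ k, ∃ y, ∀ l, l ≠ k → r l (m l) < r l y := fun k => by
    obtain ⟨y, hy⟩ := hne k
    refine ⟨y, fun l hl => ?_⟩
    obtain ⟨s, hs, hsy⟩ := hy l hl
    exact (hm l s hs).trans_lt hsy
  have hsurj : S ⊆ Finset.univ.image m := fun s hs => by
    obtain ⟨l, hl⟩ := hS s
    exact Finset.mem_image.2 ⟨l, Finset.mem_univ _, hr l (le_antisymm (hm l s hs) (hl _ (hmS l)))⟩
  have hcov : ∀ k, k = i ∨ k = j → ∀ s ∈ S, ∃ l, l ≠ k ∧ m l = s := by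
    intro k hk s hs
    obtain ⟨l, -, rfl⟩ := Finset.mem_image.1 (hsurj hs)
    by_cases hlk : l = k
    · rcases hk with rfl | rfl
      · exact ⟨j, hij.symm, by rw [hlk, hmij]⟩
      · exact ⟨i, hij, by rw [hlk, hmij]⟩
    · exact ⟨l, hlk, rfl⟩
  have hpair : ∀ k, (∀ s ∈ S, ∃ l, l ≠ k ∧ m l = s) → k = i ∨ k = j := by
    intro k hk
    by_contra! hcon
    have himg : (Finset.univ.erase k).image m = S := by
      refine Finset.Subset.antisymm (fun s hs => ?_) fun s hs => ?_
      · obtain ⟨l, -, rfl⟩ := Finset.mem_image.1 hs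
        exact hmS l
      · obtain ⟨l, hl, rfl⟩ := hk s hs
        exact Finset.mem_image_of_mem _ (Finset.mem_erase.2 ⟨hl, Finset.mem_univ _⟩)
    have hinj : Set.InjOn m (Finset.univ.erase k : Finset I) := by
      rw [← Finset.card_image_iff, himg, Finset.card_erase_of_mem (Finset.mem_univ k),
        Finset.card_univ]
      omega
    exact hij (hinj (by simpa using hcon.1.symm) (by simpa using hcon.2.symm) hmij)
  have huniq : ∀ k x y, (∀ l, l ≠ k → r l (m l) < r l x) → (∀ l, l ≠ k → r l (m l) < r l y) →
      IsDominant r (insert x S) → r k y ≤ r k x := by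
    intro k x y hx hy hdom
    obtain ⟨l, hl⟩ := hdom y
    by_cases hlk : l = k
    · exact hlk ▸ hl x (Finset.mem_insert_self _ _)
    · exact absurd (hl _ (Finset.mem_insert_of_mem (hmS l))) (not_le.2 (hy l hlk))
  obtain ⟨a, haS, hadom, ha⟩ := hS.exists_insert hmS hm i (hcov i (Or.inl rfl)) (hne' i)
  obtain ⟨b, hbS, hbdom, hb⟩ := hS.exists_insert hmS hm j (hcov j (Or.inr rfl)) (hne' j)
  rw [Finset.card_eq_two]
  refine ⟨a, b, fun hab => ?_, ?_⟩
  · obtain ⟨l, hl⟩ := hS a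
    refine absurd (hl _ (hmS l)) (not_le.2 ?_)
    by_cases hli : l = i
    · rw [hab]
      exact hb l (hli ▸ hij)
    · exact ha l hli
  · ext x
    simp only [Finset.mem_filter, Finset.mem_univ, true_and, Finset.mem_insert,
      Finset.mem_singleton]
    constructor
    · rintro ⟨hxS, hxdom⟩
      obtain ⟨k, hk, hkcov⟩ := IsDominant.le_of_insert hr hcard hmS hm hxS hxdom
      rcases hpair k hkcov with rfl | rfl
      · exact Or.inl (hr k (le_antisymm (huniq k _ _ ha hk hadom) (huniq k _ _ hk ha hxdom)))
      · exact Or.inr (hr k (le_antisymm (huniq k _ _ hb hk hbdom) (huniq k _ _ hk hb hxdom)))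
    · rintro (rfl | rfl)
      · exact ⟨haS, hadom⟩
      · exact ⟨hbS, hbdom⟩

end Scarf

/-- Exactly one colour is repeated, and exactly twice. In the parity argument this says that each
room has two doors. -/
theorem Finset.card_filter_image_erase_eq_two {V I : Type*} [DecidableEq V] [DecidableEq I]
    (c : V → I) (S : Finset V) (h : (S.image c).card + 1 = S.card) :
    (S.filter fun x => (S.erase x).image c = S.image c).card = 2 := by
  obtain ⟨a, ha, b, hb, hab, hc⟩ := Finset.exists_ne_map_eq_of_card_lt_of_maps_to
    (s := S) (t := S.image c) (f := c) (by omega) fun i hi => Finset.mem_image_of_mem c hi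
  have hkey : ∀ a ∈ S, ∀ b ∈ S, a ≠ b → c a = c b → (S.erase a).image c = S.image c := by
    intro a ha b hb hab hc
    refine (Finset.image_subset_image (Finset.erase_subset _ _)).antisymm fun i hi => ?_
    obtain ⟨s, hs, rfl⟩ := Finset.mem_image.1 hi
    by_cases hsa : s = a
    · exact Finset.mem_image.2 ⟨b, Finset.mem_erase.2 ⟨hab.symm, hb⟩, by rw [hsa, hc]⟩
    · exact Finset.mem_image_of_mem _ (Finset.mem_erase.2 ⟨hsa, hs⟩)
  rw [Finset.card_eq_two]
  refine ⟨a, b, hab, ?_⟩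
  ext x
  simp only [Finset.mem_filter, Finset.mem_insert, Finset.mem_singleton]
  constructor
  · rintro ⟨hx, him⟩
    by_contra! hcon
    have hinj : Set.InjOn c (S.erase x : Finset V) := by
      rw [← Finset.card_image_iff, him, Finset.card_erase_of_mem hx]
      omega
    exact hab (hinj (Finset.mem_erase.2 ⟨hcon.1.symm, ha⟩) (Finset.mem_erase.2 ⟨hcon.2.symm, hb⟩)
      hc)
  · rintro (rfl | rfl)
    · exact ⟨ha, hkey _ ha b hb hab hc⟩
    · exact ⟨hb, hkey _ hb a ha hab.symm hc.symm⟩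

section Scarf

open Classical in
/-- A form of **Scarf's lemma**: for every colouring of `T` by the indices of the preference
functions, there is a dominant set carrying all colours, where the slack points `Sum.inr i` have
colour `i`. -/
theorem exists_isDominant_image_eq_univ {T I α : Type*} [Fintype T] [Nonempty T] [Fintype I]
    [Nonempty I] [LinearOrder α] (r : I → T ⊕ I → α) (hr : ∀ i, Function.Injective (r i))
    (hbot : ∀ i v, v ≠ Sum.inr i → r i (Sum.inr i) < r i v)
    (htop : ∀ i j t, j ≠ i → r i (Sum.inl t) < r i (Sum.inr j)) (c : T → I) :
    ∃ S : Finset (T ⊕ I), IsDominant r S ∧ S.image (Sum.elim c id) = Finset.univ := by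
  by_contra! hcon
  set c' : T ⊕ I → I := Sum.elim c id with hc'
  obtain ⟨i₀⟩ := ‹Nonempty I›
  -- Without a fully coloured dominant set, every room has two doors, and every door opens into two
  -- rooms except `b`, which opens into one. Counting incidences equates an even number with an odd
  -- one.
  set rooms : Finset (Finset (T ⊕ I)) := Finset.univ.filter fun S =>
    IsDominant r S ∧ S.card = Fintype.card I ∧ S.image c' = Finset.univ.erase i₀ with hrooms
  set doors : Finset (Finset (T ⊕ I)) := Finset.univ.filter fun S =>
    IsDominant r S ∧ S.card + 1 = Fintype.card I ∧ S.image c' = Finset.univ.erase i₀ with hdoors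
  set b : Finset (T ⊕ I) := (Finset.univ.erase i₀).image Sum.inr with hb
  have hIpos : 0 < Fintype.card I := Fintype.card_pos_iff.2 ⟨i₀⟩
  have hbdoor : b ∈ doors := by
    simp only [hdoors, Finset.mem_filter, Finset.mem_univ, true_and]
    refine ⟨?_, ?_, ?_⟩
    · rintro (t | j)
      · refine ⟨i₀, fun x hx => ?_⟩
        obtain ⟨j, hj, rfl⟩ := Finset.mem_image.1 hx
        exact (htop i₀ j t (Finset.ne_of_mem_erase hj)).le
      · refine ⟨j, fun x hx => ?_⟩
        by_cases hxj : x = Sum.inr j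
        · rw [hxj]
        · exact (hbot j x hxj).le
    · rw [hb, Finset.card_image_of_injective _ Sum.inr_injective,
        Finset.card_erase_of_mem (Finset.mem_univ _), Finset.card_univ]
      omega
    · rw [hb, Finset.image_image]
      simp [hc', Function.comp_def]
  have habove : ∀ S ∈ doors, (rooms.bipartiteAbove (· ⊆ ·) S).card =
      (Finset.univ.filter fun x => x ∉ S ∧ IsDominant r (insert x S)).card := by
    intro S hS
    simp only [hdoors, Finset.mem_filter, Finset.mem_univ, true_and] at hS
    obtain ⟨hSdom, hScard, hSim⟩ := hS
    symm
    refine Finset.card_bij (fun x _ => insert x S) ?_ ?_ ?_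
    · intro x hx
      simp only [Finset.mem_filter, Finset.mem_univ, true_and] at hx
      simp only [Finset.mem_bipartiteAbove, hrooms, Finset.mem_filter, Finset.mem_univ, true_and]
      refine ⟨⟨hx.2, by rw [Finset.card_insert_of_notMem hx.1, hScard], ?_⟩,
        Finset.subset_insert _ _⟩
      have hx0 := hcon _ hx.2
      rw [Finset.image_insert, hSim] at hx0 ⊢
      refine Finset.insert_eq_of_mem (Finset.mem_erase.2 ⟨fun h => hx0 ?_, Finset.mem_univ _⟩)
      rw [h, Finset.insert_erase (Finset.mem_univ _)]
    · intro x hx y hy hxy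
      simp only [Finset.mem_filter, Finset.mem_univ, true_and] at hx hy
      have : x ∈ insert y S := hxy ▸ Finset.mem_insert_self x S
      exact (Finset.mem_insert.1 this).resolve_right hx.1
    · intro R hR
      simp only [Finset.mem_bipartiteAbove, hrooms, Finset.mem_filter, Finset.mem_univ,
        true_and] at hR
      obtain ⟨⟨hRdom, hRcard, hRim⟩, hSR⟩ := hR
      obtain ⟨x, hx, rfl⟩ := (Finset.covBy_iff_exists_insert (s := S) (t := R)).1
        (Finset.covBy_iff_card_sdiff_eq_one.2 ⟨hSR, by
          rw [Finset.card_sdiff_of_subset hSR]; omega⟩)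
      exact ⟨x, by simpa using ⟨hx, hRdom⟩, rfl⟩
  have hbelow : ∀ R ∈ rooms, (doors.bipartiteBelow (· ⊆ ·) R).card = 2 := by
    intro R hR
    simp only [hrooms, Finset.mem_filter, Finset.mem_univ, true_and] at hR
    obtain ⟨hRdom, hRcard, hRim⟩ := hR
    rw [← Finset.card_filter_image_erase_eq_two c' R (by
      rw [hRim, Finset.card_erase_of_mem (Finset.mem_univ _), Finset.card_univ]; omega)]
    symm
    refine Finset.card_bij (fun x _ => R.erase x) ?_ ?_ ?_
    · intro x hx
      simp only [Finset.mem_filter] at hx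
      simp only [Finset.mem_bipartiteBelow, hdoors, Finset.mem_filter, Finset.mem_univ, true_and]
      refine ⟨⟨hRdom.mono (Finset.erase_subset _ _), ?_, hx.2.trans hRim⟩, Finset.erase_subset _ _⟩
      rw [Finset.card_erase_of_mem hx.1]
      omega
    · intro x hx y hy hxy
      simp only [Finset.mem_filter] at hx hy
      exact Finset.erase_injOn R hx.1 hy.1 hxy
    · intro S hS
      simp only [Finset.mem_bipartiteBelow, hdoors, Finset.mem_filter, Finset.mem_univ,
        true_and] at hS
      obtain ⟨⟨hSdom, hScard, hSim⟩, hSR⟩ := hS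
      obtain ⟨x, hx, rfl⟩ := (Finset.covBy_iff_exists_insert (s := S) (t := R)).1
        (Finset.covBy_iff_card_sdiff_eq_one.2 ⟨hSR, by
          rw [Finset.card_sdiff_of_subset hSR]; omega⟩)
      refine ⟨x, ?_, Finset.erase_insert hx⟩
      simp only [Finset.mem_filter, Finset.mem_insert_self, true_and, Finset.erase_insert hx]
      rw [hSim, hRim]
  have hbcount : (rooms.bipartiteAbove (· ⊆ ·) b).card = 1 := by
    rw [habove b hbdoor, Finset.card_eq_one]
    obtain ⟨t₀, -, ht₀⟩ := Finset.exists_max_image (Finset.univ : Finset T)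
      (fun t => r i₀ (Sum.inl t)) Finset.univ_nonempty
    have hmem : ∀ j, j ≠ i₀ → (Sum.inr j : T ⊕ I) ∈ b := fun j hj =>
      Finset.mem_image_of_mem _ (Finset.mem_erase.2 ⟨hj, Finset.mem_univ _⟩)
    refine ⟨Sum.inl t₀, ?_⟩
    ext x
    simp only [Finset.mem_filter, Finset.mem_univ, true_and, Finset.mem_singleton]
    have hle : ∀ x, IsDominant r (insert x b) → ∀ t, r i₀ (Sum.inl t) ≤ r i₀ x := by
      intro x hx t
      obtain ⟨i, hi⟩ := hx (Sum.inl t)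
      by_cases hi0 : i = i₀
      · exact hi0 ▸ hi x (Finset.mem_insert_self _ _)
      · exact absurd (hi _ (Finset.mem_insert_of_mem (hmem i hi0))) (not_le.2 (hbot _ _ (by simp)))
    constructor
    · rintro ⟨hxb, hx⟩
      rcases x with t | j
      · exact hr i₀ (le_antisymm (ht₀ t (Finset.mem_univ _)) (hle _ hx t₀))
      · have hj : j = i₀ := by_contra fun hj => hxb (hmem j hj)
        exact absurd (hle _ hx t₀) (not_le.2 (hj ▸ hbot _ _ (by simp)))
    · rintro rfl
      refine ⟨by simp [hb], ?_⟩
      rintro (t | j)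
      · refine ⟨i₀, fun x hx => ?_⟩
        rcases Finset.mem_insert.1 hx with rfl | hx
        · exact ht₀ t (Finset.mem_univ _)
        · obtain ⟨j, hj, rfl⟩ := Finset.mem_image.1 hx
          exact (htop i₀ j t (Finset.ne_of_mem_erase hj)).le
      · refine ⟨j, fun x _ => ?_⟩
        by_cases hxj : x = Sum.inr j
        · rw [hxj]
        · exact (hbot j x hxj).le
  have hcount : ∀ S ∈ doors.erase b, (rooms.bipartiteAbove (· ⊆ ·) S).card = 2 := by
    intro S hS
    obtain ⟨hSb, hSd⟩ := Finset.mem_erase.1 hS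
    rw [habove S hSd]
    simp only [hdoors, Finset.mem_filter, Finset.mem_univ, true_and] at hSd
    obtain ⟨hSdom, hScard, hSim⟩ := hSd
    obtain ⟨t, ht⟩ : ∃ t, Sum.inl t ∈ S := by
      by_contra! hno
      refine hSb ?_
      ext x
      rcases x with t | j
      · simp [hno t, hb]
      · have : j ∈ S.image c' ↔ Sum.inr j ∈ S := by
          simp [hc', hno]
        rw [← this, hSim]
        simp [hb]
    -- The slack point of `k` beats the point `t` for every `l ≠ k`, so `S` is not extremal.
    refine hSdom.card_insert_eq_two hr ⟨_, ht⟩ hScard fun k => ⟨Sum.inr k, fun l hl => ?_⟩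
    exact ⟨Sum.inl t, ht, htop l k t hl.symm⟩
  have hsum := Finset.sum_card_bipartiteAbove_eq_sum_card_bipartiteBelow
    (s := doors) (t := rooms) (· ⊆ ·)
  rw [Finset.sum_congr rfl hbelow, ← Finset.add_sum_erase _ _ hbdoor, hbcount,
    Finset.sum_congr rfl hcount, Finset.sum_const, Finset.sum_const, smul_eq_mul, smul_eq_mul] at hsum
  omega

end Scarf

/-! ### Brouwer's theorem from grid colourings. -/

/-- For a colouring of the grid points of sum `N` in the scaled simplex there is a small cell such
that every colour occurs in the cell, or else the cell is close to the corresponding face. -/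
theorem exists_small_colorful_cell {I : Type*} [Fintype I] [Nonempty I] (N : ℕ)
    (c : (I → ℕ) → I) :
    ∃ (σ : Set (I → ℕ)) (m : I → ℕ), σ.Nonempty ∧
      (∀ x ∈ σ, ∑ i, x i = N ∧ ∀ i, m i ≤ x i ∧ x i ≤ m i + Fintype.card I) ∧
      ∀ i, m i = 0 ∨ ∃ x ∈ σ, c x = i := by
  classical
  let T := {x : I → Fin (N + 1) // ∑ i, (x i : ℕ) = N}
  let toT : ∀ x : I → ℕ, ∑ i, x i = N → T := fun x hx =>
    ⟨fun i => ⟨x i, Nat.lt_succ_of_le (hx ▸ Finset.single_le_sum (f := x) (fun _ _ => Nat.zero_le _)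
      (Finset.mem_univ i))⟩, hx⟩
  let ofT : T → I → ℕ := fun t i => t.1 i
  have hT : Nonempty T := by
    obtain ⟨i₀⟩ := ‹Nonempty I›
    exact ⟨toT (Pi.single i₀ N) (by simp)⟩
  -- The shift by 1 puts grid values in `[1, N + 1]`, strictly between the slack values `0` and `N +
  -- 2`. Ties are broken by the enumeration `e`.
  let f : I → T ⊕ I → ℕ := fun i => Sum.elim (fun t => ofT t i + 1)
    fun j => if j = i then 0 else N + 2
  let e := Fintype.equivFin (T ⊕ I)
  have hlt : ∀ i t, ofT t i < N + 1 := fun i t => (t.1 i).2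
  obtain ⟨S, hS, hSc⟩ := exists_isDominant_image_eq_univ
    (fun i v => toLex (f i v, e v)) (fun i v w h => e.injective
      (Prod.ext_iff.1 (toLex.injective h)).2)
    (fun i v hv => by
      refine Prod.Lex.toLex_lt_toLex.2 (Or.inl ?_)
      rcases v with t | j
      · simp [f]
      · have : j ≠ i := fun h => hv (h ▸ rfl)
        simp [f, this])
    (fun i j t hj => by
      refine Prod.Lex.toLex_lt_toLex.2 (Or.inl ?_)
      have := hlt i t
      simp only [f, Sum.elim_inl, Sum.elim_inr, hj, if_false]
      omega) (fun t => c (ofT t))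
  have hdom : ∀ t, ∃ i, Sum.inr i ∉ S ∧ ∀ t', Sum.inl t' ∈ S → ofT t i ≤ ofT t' i := by
    intro t
    obtain ⟨i, hi⟩ := hS (Sum.inl t)
    have hle : ∀ x ∈ S, f i (Sum.inl t) ≤ f i x := fun x hx => by
      rcases Prod.Lex.toLex_le_toLex.1 (hi x hx) with h | h
      · exact h.le
      · exact h.1.le
    refine ⟨i, fun h => ?_, fun t' ht' => ?_⟩
    · simpa [f] using hle _ h
    · simpa [f] using hle _ ht'
  have hcol : ∀ i, Sum.inr i ∉ S → ∃ t, Sum.inl t ∈ S ∧ c (ofT t) = i := by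
    intro i hi
    obtain ⟨s, hs, hsi⟩ := Finset.mem_image.1 (hSc ▸ Finset.mem_univ i)
    rcases s with t | j
    · exact ⟨t, hs, hsi⟩
    · exact absurd ((show j = i from hsi) ▸ hs) hi
  obtain ⟨i₀, hi₀, -⟩ := hdom hT.some
  obtain ⟨t₀, ht₀, -⟩ := hcol i₀ hi₀
  have hmin : ∀ i, ∃ t, Sum.inl t ∈ S ∧ ∀ t', Sum.inl t' ∈ S → ofT t i ≤ ofT t' i := fun i => by
    obtain ⟨t, ht, hmin⟩ := Finset.exists_min_image
      (Finset.univ.filter fun t : T => Sum.inl t ∈ S) (fun t => ofT t i) ⟨t₀, by simpa using ht₀⟩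
    exact ⟨t, by simpa using ht, fun t' ht' => hmin t' (by simpa using ht')⟩
  choose μ hμS hμ using hmin
  let m : I → ℕ := fun i => if Sum.inr i ∈ S then 0 else ofT (μ i) i
  let k : I → ℕ := fun i => if Sum.inr i ∈ S then 0 else 1
  -- Otherwise some grid point would exceed `m i` at every `i` with `Sum.inr i ∉ S`, against
  -- dominance. This bounds the width of the cell by `∑ i, k i`.
  have hsum : N < ∑ i, (m i + k i) := by
    by_contra! hle
    let x : I → ℕ := fun i => m i + k i + Pi.single (M := fun _ => ℕ) i₀ (N - ∑ i, (m i + k i)) i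
    have hx : ∑ i, x i = N := by
      simp only [x]
      rw [Finset.sum_add_distrib (f := fun i => m i + k i), Finset.sum_pi_single',
        if_pos (Finset.mem_univ _)]
      omega
    obtain ⟨i, hiS, hi⟩ := hdom (toT x hx)
    have := hi _ (hμS i)
    simp only [ofT, toT, x, m, k, hiS, if_false] at this
    omega
  have hk : ∑ i, k i ≤ Fintype.card I := by
    refine (Finset.sum_le_card_nsmul _ k 1 fun i _ => ?_).trans (by simp)
    simp only [k]
    split_ifs <;> simp
  refine ⟨ofT '' {t | Sum.inl t ∈ S}, m, ⟨_, t₀, ht₀, rfl⟩, ?_, fun i => ?_⟩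
  · rintro _ ⟨t, ht, rfl⟩
    have hmle : ∀ i, m i ≤ ofT t i := fun i => by
      simp only [m]
      split_ifs
      · exact Nat.zero_le _
      · exact hμ i t ht
    have htN : ∑ i, ofT t i = N := t.2
    refine ⟨htN, fun i => ⟨hmle i, ?_⟩⟩
    rw [Finset.sum_add_distrib] at hsum
    rw [← Finset.add_sum_erase _ _ (Finset.mem_univ i)] at htN
    rw [← Finset.add_sum_erase _ m (Finset.mem_univ i)] at hsum
    have := Finset.sum_le_sum fun j (_ : j ∈ Finset.univ.erase i) => hmle j
    omega
  · by_cases hi : Sum.inr i ∈ S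
    · exact Or.inl (if_pos hi)
    · obtain ⟨t, ht, htc⟩ := hcol i hi
      exact Or.inr ⟨_, ⟨t, ht, rfl⟩, htc⟩

theorem exists_le_add_of_mapsTo_stdSimplex {I : Type*} [Fintype I] [Nonempty I]
    {f : (I → ℝ) → I → ℝ} (hf : ContinuousOn f (stdSimplex ℝ I))
    (hmaps : Set.MapsTo f (stdSimplex ℝ I) (stdSimplex ℝ I)) {ε : ℝ} (hε : 0 < ε) :
    ∃ x ∈ stdSimplex ℝ I, ∀ i, x i ≤ f x i + ε := by
  classical
  obtain ⟨δ, hδ, hfδ⟩ := Metric.uniformContinuousOn_iff.1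
    ((isCompact_stdSimplex ℝ I).uniformContinuousOn_of_continuous hf) (ε / 2) (half_pos hε)
  obtain ⟨N, hN⟩ := exists_nat_gt ((Fintype.card I : ℝ) / min δ (ε / 2))
  have hmin : 0 < min δ (ε / 2) := lt_min hδ (half_pos hε)
  have hN0 : (0 : ℝ) < N := lt_of_le_of_lt (by positivity) hN
  have hsmall : (Fintype.card I : ℝ) / N < min δ (ε / 2) := by
    rw [div_lt_iff₀ hmin] at hN
    rw [div_lt_iff₀ hN0]
    linarith
  let p : (I → ℕ) → I → ℝ := fun x i => (x i : ℝ) / N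
  have hp : ∀ x : I → ℕ, ∑ i, x i = N → p x ∈ stdSimplex ℝ I := fun x hx => by
    refine ⟨fun i => by positivity, ?_⟩
    rw [← Finset.sum_div, ← Nat.cast_sum, hx, div_self hN0.ne']
  have hcol : ∀ x : I → ℕ, ∑ i, x i = N → ∃ i, p x i ≤ f (p x) i := fun x hx => by
    obtain ⟨i, -, hi⟩ := Finset.exists_le_of_sum_le (s := Finset.univ) (f := p x) (g := f (p x))
      Finset.univ_nonempty (by rw [(hp x hx).2, (hmaps (hp x hx)).2])
    exact ⟨i, hi⟩
  -- A grid point gets a coordinate that `f` does not decrease; one exists because both coordinate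
  -- sums are 1. Colours off the grid are arbitrary.
  obtain ⟨σ, m, ⟨a, ha⟩, hσ, hc⟩ := exists_small_colorful_cell N
    fun x => Classical.epsilon fun i => p x i ≤ f (p x) i
  have hclose : ∀ x ∈ σ, ∀ y ∈ σ, ∀ i, p x i ≤ p y i + Fintype.card I / N := by
    intro x hx y hy i
    have : (x i : ℝ) ≤ y i + Fintype.card I := by
      have h1 := ((hσ x hx).2 i).2
      have h2 := ((hσ y hy).2 i).1
      exact_mod_cast h1.trans (by omega)
    simp only [p]
    rw [← add_div]
    gcongr
  refine ⟨p a, hp a (hσ a ha).1, fun i => ?_⟩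
  rcases hc i with hi | ⟨x, hx, hxi⟩
  · have h1 : (a i : ℝ) ≤ Fintype.card I := by
      have := ((hσ a ha).2 i).2
      rw [hi, zero_add] at this
      exact_mod_cast this
    have h2 : p a i ≤ Fintype.card I / N := by
      simp only [p]
      gcongr
    have h3 := (hmaps (hp a (hσ a ha).1)).1 i
    have h4 := hsmall.trans_le (min_le_right _ _)
    linarith
  · have h1 : p x i ≤ f (p x) i := by
      have := Classical.epsilon_spec (hcol x (hσ x hx).1)
      rwa [hxi] at this
    have hdist : dist (p x) (p a) < δ := by
      refine (dist_pi_lt_iff hδ).2 fun j => (lt_of_le_of_lt ?_ hsmall).trans_le (min_le_left _ _)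
      rw [Real.dist_eq, abs_le]
      constructor <;> linarith [hclose x hx a ha j, hclose a ha x hx j]
    have h2 := (dist_le_pi_dist (f (p x)) (f (p a)) i).trans_lt
      (hfδ _ (hp x (hσ x hx).1) _ (hp a (hσ a ha).1) hdist)
    rw [Real.dist_eq] at h2
    have h3 := (abs_lt.1 h2).2
    have h4 := hclose a ha x hx i
    have h5 := hsmall.trans_le (min_le_right _ _)
    linarith

/-- **Brouwer's fixed point theorem** for the standard simplex. -/
theorem exists_fixedPoint_stdSimplex {I : Type*} [Fintype I] [Nonempty I]
    {f : (I → ℝ) → I → ℝ} (hf : ContinuousOn f (stdSimplex ℝ I))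
    (hmaps : Set.MapsTo f (stdSimplex ℝ I) (stdSimplex ℝ I)) :
    ∃ x ∈ stdSimplex ℝ I, f x = x := by
  classical
  have hne : (stdSimplex ℝ I).Nonempty := ⟨_, single_mem_stdSimplex ℝ (Classical.arbitrary I)⟩
  -- The total excess attains its minimum, which approximate fixed points force to be 0. Then `x ≤ f
  -- x` coordinatewise with equal sums, hence equality.
  have hcont : ContinuousOn (fun x => ∑ i, max 0 (x i - f x i)) (stdSimplex ℝ I) := by
    refine continuousOn_finsetSum _ fun i _ => ContinuousOn.sup continuousOn_const ?_
    exact (continuous_apply i).continuousOn.sub (continuousOn_pi.1 hf i)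
  obtain ⟨x, hx, hxmin⟩ := (isCompact_stdSimplex ℝ I).exists_isMinOn hne hcont
  have hcard : (0 : ℝ) < Fintype.card I := by exact_mod_cast Fintype.card_pos
  have hle : ∑ i, max 0 (x i - f x i) ≤ 0 := by
    refine le_of_forall_pos_le_add fun ε hε => ?_
    obtain ⟨y, hy, hyε⟩ := exists_le_add_of_mapsTo_stdSimplex hf hmaps (div_pos hε hcard)
    refine (hxmin hy).trans ?_
    calc ∑ i, max 0 (y i - f y i) ≤ ∑ _i : I, ε / Fintype.card I :=
          Finset.sum_le_sum fun i _ => max_le (div_pos hε hcard).le (by linarith [hyε i])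
      _ = 0 + ε := by
          rw [Finset.sum_const, Finset.card_univ, nsmul_eq_mul, mul_div_cancel₀ _ hcard.ne', zero_add]
  have hxf : ∀ i ∈ Finset.univ, x i ≤ f x i := fun i _ => by
    have := (Finset.single_le_sum (f := fun i => max 0 (x i - f x i))
      (fun _ _ => le_max_left _ _) (Finset.mem_univ i)).trans hle
    linarith [le_max_right 0 (x i - f x i)]
  refine ⟨x, hx, funext fun i => ?_⟩
  exact ((Finset.sum_eq_sum_iff_of_le hxf).1 (hx.2.trans (hmaps hx).2.symm) i
    (Finset.mem_univ i)).symm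

/-! ### The KKM lemma. -/

/-- The **Knaster–Kuratowski–Mazurkiewicz lemma** for the standard simplex. -/
theorem exists_mem_forall_mem_of_stdSimplex {I : Type*} [Fintype I] [Nonempty I]
    {A : I → Set (I → ℝ)} (hA : ∀ i, IsClosed (A i))
    (hcov : ∀ x ∈ stdSimplex ℝ I, ∃ i, 0 < x i ∧ x ∈ A i) :
    ∃ x ∈ stdSimplex ℝ I, ∀ i, x ∈ A i := by
  classical
  by_contra! hcon
  have hAne : ∀ i, (A i).Nonempty := fun i => by
    obtain ⟨j, hj, hjA⟩ := hcov _ (single_mem_stdSimplex ℝ i)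
    by_cases hji : j = i
    · exact ⟨_, hji ▸ hjA⟩
    · simp [hji] at hj
  let d : (I → ℝ) → I → ℝ := fun x i => Metric.infDist x (A i)
  have hd : Continuous d := continuous_pi fun i => Metric.continuous_infDist_pt _
  have hd0 : ∀ x i, 0 ≤ d x i := fun x i => Metric.infDist_nonneg
  have hdA : ∀ x i, x ∈ A i ↔ d x i = 0 := fun x i => (hA i).mem_iff_infDist_zero (hAne i)
  have hpos : ∀ x ∈ stdSimplex ℝ I, 0 < ∑ i, d x i := fun x hx => by
    obtain ⟨i, hi⟩ := hcon x hx
    exact Finset.sum_pos' (fun i _ => hd0 x i)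
      ⟨i, Finset.mem_univ i, (hd0 x i).lt_of_ne' ((hdA x i).not.1 hi)⟩
  -- At a fixed point of the normalised distance vector, `x ∈ A i` forces `x i = 0`, against the
  -- covering condition.
  obtain ⟨x, hx, hfx⟩ := exists_fixedPoint_stdSimplex
    (f := fun x => (∑ i, d x i)⁻¹ • d x)
    (((continuous_finsetSum _ fun i _ => (continuous_apply i).comp hd).continuousOn.inv₀
      fun x hx => (hpos x hx).ne').smul hd.continuousOn)
    fun x hx => ⟨fun i => mul_nonneg (inv_nonneg.2 (hpos x hx).le) (hd0 x i), by
      simp only [Pi.smul_apply, smul_eq_mul]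
      rw [← Finset.mul_sum, inv_mul_cancel₀ (hpos x hx).ne']⟩
  obtain ⟨i, hi, hiA⟩ := hcov x hx
  have := congrFun hfx i
  simp only [Pi.smul_apply, (hdA x i).1 hiA, smul_zero] at this
  exact hi.ne this

/-- The finite intersection property of **KKM maps** with closed values. -/
theorem Finset.exists_forall_mem_of_convexHull_subset {X : Type*} [AddCommGroup X] [Module ℝ X]
    [TopologicalSpace X] [ContinuousAdd X] [ContinuousSMul ℝ X] (t : Finset X) (ht : t.Nonempty)
    (G : X → Set X) (hG : ∀ y ∈ t, IsClosed (G y))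
    (hKKM : ∀ u ⊆ t, convexHull ℝ (u : Set X) ⊆ ⋃ y ∈ u, G y) :
    ∃ x ∈ convexHull ℝ (t : Set X), ∀ y ∈ t, x ∈ G y := by
  classical
  have : Nonempty t := ht.to_subtype
  let φ : (t → ℝ) → X := fun w => ∑ y, w y • (y : X)
  have hφ : Continuous φ := continuous_finsetSum _ fun y _ =>
    (continuous_apply y).smul continuous_const
  obtain ⟨w, hw, hwA⟩ := exists_mem_forall_mem_of_stdSimplex (A := fun y : t => φ ⁻¹' G y)
    (fun y => (hG y y.2).preimage hφ) fun w hw => by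
      -- Applying the KKM condition to the support of `w` alone yields an index of positive weight.
      let u : Finset t := Finset.univ.filter fun y => 0 < w y
      have hu : ∀ y ∉ u, w y = 0 := fun y hy =>
        ((hw.1 y).antisymm (by simpa [u] using hy)).symm
      have hmem : φ w ∈ convexHull ℝ ((u.image Subtype.val : Finset X) : Set X) := by
        have h1 : φ w = ∑ y ∈ u, w y • (y : X) :=
          (Finset.sum_subset (Finset.subset_univ u) fun y _ hy => by rw [hu y hy, zero_smul]).symm
        rw [h1]
        refine (convex_convexHull ℝ _).sum_mem (fun y _ => hw.1 y) ?_ fun y hy =>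
          subset_convexHull ℝ _ (Finset.mem_coe.2 (Finset.mem_image_of_mem _ hy))
        rw [← hw.2]
        exact Finset.sum_subset (Finset.subset_univ u) fun y _ hy => hu y hy
      have := hKKM (u.image Subtype.val) (fun x hx => by
        obtain ⟨y, -, rfl⟩ := Finset.mem_image.1 hx
        exact y.2) hmem
      simp only [Set.mem_iUnion] at this
      obtain ⟨x, hx, hxG⟩ := this
      obtain ⟨y, hy, rfl⟩ := Finset.mem_image.1 hx
      exact ⟨y, (Finset.mem_filter.1 hy).2, hxG⟩
  refine ⟨φ w, ?_, fun y hy => hwA ⟨y, hy⟩⟩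
  exact (convex_convexHull ℝ _).sum_mem (fun y _ => hw.1 y) hw.2 fun y _ =>
    subset_convexHull ℝ _ y.2

/-! ### Self segment-density, set-valued maps and the main theorem. -/

/-- A self segment-dense set is dense in the convex hull of each of its finite subsets. -/
theorem IsSelfSegmentDense.convexHull_subset_closure {X : Type*} [AddCommGroup X] [Module ℝ X]
    [TopologicalSpace X] [ContinuousAdd X] [ContinuousSMul ℝ X] {U V : Set X}
    (h : IsSelfSegmentDense U V) (t : Finset X) (ht : (t : Set X) ⊆ U) :
    convexHull ℝ (t : Set X) ⊆ closure (convexHull ℝ (t : Set X) ∩ U) := by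
  classical
  induction t using Finset.induction_on with
  | empty => simp
  | insert y t _ ih =>
    rw [Finset.coe_insert] at ht ⊢
    obtain ⟨hy, htU⟩ := Set.insert_subset_iff.1 ht
    rcases t.eq_empty_or_nonempty with rfl | htne
    · simpa using subset_closure (show y ∈ {y} ∩ U from ⟨rfl, hy⟩)
    rw [convexHull_insert (by exact_mod_cast htne)]
    intro p hp
    obtain ⟨y, rfl, q, hq, a, b, ha, hb, hab, rfl⟩ := mem_convexJoin.1 hp
    -- `q` is first approximated by points `z` of `U` in the smaller hull; segment-density then
    -- applies to `[y, z]`.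
    have hcont : Continuous fun q : X => a • y + b • q := by fun_prop
    have himg := image_closure_subset_closure_image hcont ⟨q, ih htU hq, rfl⟩
    refine closure_minimal ?_ isClosed_closure himg
    rintro _ ⟨z, ⟨hz, hzU⟩, rfl⟩
    refine closure_mono (Set.inter_subset_inter_left _ fun x hx => ?_)
      (h.segment_dense _ hy z hzU ⟨a, b, ha, hb, hab, rfl⟩)
    exact mem_convexJoin.2 ⟨_, rfl, z, hz, hx⟩

/-- If a set-valued map, convex on `D`, has only nonnegative values at a point of `D` in the convex
hull of finitely many points of `D`, then the same holds at one of these points. -/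
theorem SetValuedConvexOn.exists_subset_Ici {X : Type*} [AddCommGroup X] [Module ℝ X] {D : Set X}
    {T : X → Set ℝ} (hT : SetValuedConvexOn D T) {u : Finset X} (hu : (u : Set X) ⊆ D) {x : X}
    (hx : x ∈ convexHull ℝ (u : Set X)) (hxD : x ∈ D) (hTx : T x ⊆ Set.Ici 0) :
    ∃ y ∈ u, T y ⊆ Set.Ici 0 := by
  by_contra! hcon
  obtain ⟨w, hw0, hw1, rfl⟩ := Finset.mem_convexHull'.1 hx
  have hneg : ∀ y : u, ∃ z ∈ T y, z < 0 := fun y => by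
    obtain ⟨z, hz, hz0⟩ := Set.not_subset.1 (hcon y y.2)
    exact ⟨z, hz, not_le.1 hz0⟩
  choose z hzT hz0 using hneg
  let e := u.equivFin.symm
  have hw1' : ∑ i, w (e i) = 1 := by
    rw [Equiv.sum_comp e fun y : u => w y, Finset.sum_coe_sort, hw1]
  have hwx : ∑ i, w (e i) • (e i : X) = ∑ y ∈ u, w y • y := by
    rw [Equiv.sum_comp e fun y : u => w y • (y : X), Finset.sum_coe_sort u fun y => w y • y]
  have hmem := hT _ (fun i => e i) (fun i => w (e i)) (fun i => hu (e i).2)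
    (fun i => hw0 _ (e i).2) hw1' (hwx ▸ hxD)
    (Set.finsetSum_mem_finsetSum _ _ (fun i => w (e i) • z (e i)) fun i _ =>
      Set.smul_mem_smul_set (hzT (e i)))
  rw [hwx] at hmem
  refine not_lt.2 (Set.mem_Ici.1 (hTx hmem)) ?_
  obtain ⟨i, -, hi⟩ := Finset.exists_lt_of_sum_lt (s := Finset.univ) (f := fun _ => (0 : ℝ))
    (g := fun i => w (e i)) (by simp [hw1'])
  exact Finset.sum_neg' (fun i _ => mul_nonpos_of_nonneg_of_nonpos (hw0 _ (e i).2) (hz0 _).le)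
    ⟨i, Finset.mem_univ i, mul_neg_of_pos_of_neg hi (hz0 _)⟩

/-- A value meeting the open complement of `C` would force all nearby values to meet it too. -/
theorem LowerHemicontinuousOn.isClosed_inter_setOf_subset {X Y : Type*} [TopologicalSpace X]
    [TopologicalSpace Y] {T : X → Set Y} {K : Set X} (hT : LowerHemicontinuousOn T K)
    (hK : IsClosed K) {C : Set Y} (hC : IsClosed C) : IsClosed (K ∩ {x | T x ⊆ C}) := by
  refine isClosed_of_closure_subset fun x hx => ?_
  have hxK : x ∈ K := hK.closure_subset_iff.2 Set.inter_subset_left hx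
  refine ⟨hxK, LowerHemicontinuousWithinAt.frequently (hT x hxK) C hC (frequently_nhdsWithin_iff.2 ?_)⟩
  exact (mem_closure_iff_frequently.1 hx).mono fun _ h => h.symm

theorem theorem3p2 {X : Type*} [AddCommGroup X] [Module ℝ X] [TopologicalSpace X]
    [IsTopologicalAddGroup X] [ContinuousSMul ℝ X] [LocallyConvexSpace ℝ X] [T2Space X]
    (K D : Set X) (hKne : K.Nonempty) (hKconv : Convex ℝ K) (hKcomp : IsCompact K)
    (hD : IsSelfSegmentDense D K) (F : X → X → Set ℝ)
    (h_lsc_left : ∀ y ∈ D, LowerHemicontinuousOn (fun x => F x y) K)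
    (h_lsc_right : ∀ x ∈ K, ∀ y ∈ K \ D, LowerHemicontinuousWithinAt (fun z => F x z) K y)
    (h_convex : ∀ x ∈ D, SetValuedConvexOn D (fun y => F x y))
    (h_diag : ∀ x ∈ D, F x x ⊆ Set.Ici 0) :
    ∃ x₀ ∈ K, ∀ y ∈ K, F x₀ y ⊆ Set.Ici 0 := by
  have hclosed : ∀ y ∈ D, IsClosed (K ∩ {x | F x y ⊆ Set.Ici 0}) := fun y hy =>
    (h_lsc_left y hy).isClosed_inter_setOf_subset hKcomp.isClosed isClosed_Ici
  have hKKM : ∀ u : Finset X, (u : Set X) ⊆ D →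
      convexHull ℝ (u : Set X) ⊆ ⋃ y ∈ u, K ∩ {x | F x y ⊆ Set.Ici 0} := fun u hu => by
    refine (hD.convexHull_subset_closure u hu).trans (closure_minimal ?_
      (isClosed_biUnion_finset fun y hy => hclosed y (hu hy)))
    rintro x ⟨hx, hxD⟩
    obtain ⟨y, hy, hxy⟩ := (h_convex x hxD).exists_subset_Ici hu hx hxD (h_diag x hxD)
    exact Set.mem_biUnion hy ⟨hD.subset hxD, hxy⟩
  obtain ⟨x₀, hx₀, hx₀D⟩ := hKcomp.inter_iInter_nonempty
    (fun y : D => K ∩ {x | F x y ⊆ Set.Ici 0}) (fun y => hclosed y y.2) fun t => by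
      rcases t.eq_empty_or_nonempty with rfl | ht
      · simpa using hKne
      let u : Finset X := t.map (Function.Embedding.subtype _)
      have hu : (u : Set X) ⊆ D := by simp [u]
      obtain ⟨x, hx, hxu⟩ := u.exists_forall_mem_of_convexHull_subset (by simpa [u] using ht)
        (fun y => K ∩ {x | F x y ⊆ Set.Ici 0}) (fun y hy => hclosed y (hu hy))
        fun v hv => hKKM v ((Finset.coe_subset.2 hv).trans hu)
      refine ⟨x, convexHull_min (hu.trans hD.subset) hKconv hx, Set.mem_iInter₂.2 fun y hy => ?_⟩
      exact hxu y (Finset.mem_map_of_mem _ hy)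
  have hx₀F : ∀ y ∈ D, F x₀ y ⊆ Set.Ici 0 := fun y hy => (Set.mem_iInter.1 hx₀D ⟨y, hy⟩).2
  refine ⟨x₀, hx₀, fun y hy => ?_⟩
  by_cases hyD : y ∈ D
  · exact hx₀F y hyD
  -- `y` is a limit of points of `D`, where the inclusion is known.
  · refine LowerHemicontinuousWithinAt.frequently (h_lsc_right x₀ hx₀ y ⟨hy, hyD⟩) _ isClosed_Ici
      (frequently_nhdsWithin_iff.2 ?_)
    exact (mem_closure_iff_frequently.1 (hD.dense hy)).mono fun z hz =>
      ⟨hx₀F z hz, hD.subset hz⟩
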